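/- Let $V$ be a finite set of nodes and let $P=(p_{ij})_{i,j\in V}$ be an irreducible row-stochastic real matrix, i.e. the network whose links are the pairs $(i,j)$ with $p_{ij}>0$ is strongly connected. Let $X_0,X_1,X_2,\dots$ be independent agents, defined on a common probability space, each performing a random walk $(X_n(t))_{t\ge 0}$ on $V$, i.e. a Markov chain with transition matrix $P$ and an arbitrary initial distribution (which may differ between agents). For $N\ge 1$ and $T\ge 1$ let the link flow $$R^{(N,T)}_{ij}=\sum_{n=0}^{N-1}\#\{\,0\le t<T : X_n(t)=i,\ X_n(t+1)=j\,\}$$ be the number of times the first $N$ agents traverse the link $(i,j)$ during the period $T$, and let the relative flow be $R^{(N,T)}/\min R^{(N,T)}$, where $\min R^{(N,T)}$ is the smallest nonzero entry of $R^{(N,T)}$. A real matrix $F=(f_{ij})_{i,j\in V}$ is called the ideal flow matrix of this system if, almost surely, $R^{(N,T)}/\min R^{(N,T)}\to F$ as $T\to\infty$, uniformly in $N\ge 1$ (so that the number of agents may be fixed or vary with $T$ in any way). Then the ideal flow matrix exists, and it is premagic, i.e. its vector of row sums equals its vector of column sums: $\sum_{j} f_{ij}=\sum_{j} f_{ji}$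 for every $i\in V$. -/

import Mathlib

open Filter Topology MeasureTheory ProbabilityTheory Matrix

noncomputable section

variable {V Ω : Type*}

/-- A square matrix is premagic if its vector of column sums `jᵀ M` equals its vector of
row sums `M j`, where `j` is the all-ones vector. -/
def IsPremagic [Fintype V] (M : Matrix V V ℝ) : Prop :=
  (fun _ => 1) ᵥ* M = M *ᵥ (fun _ => 1)

/-- The process `Y` on the nodes `V` is a random walk (a time-homogeneous Markov chain, with an
arbitrary initial distribution) with transition matrix `P`: given any initial segment of its
trajectory up to time `t`, it moves to `w` at time `t + 1` with probability `P (Y t) w`. -/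
structure IsRandomWalk [MeasurableSpace V] [MeasurableSpace Ω] (P : Matrix V V ℝ)
    (μ : Measure Ω) (Y : ℕ → Ω → V) : Prop where
  measurable : ∀ t, Measurable (Y t)
  transition : ∀ (t : ℕ) (v : ℕ → V),
    μ.real {ω | ∀ s ≤ t + 1, Y s ω = v s} =
      μ.real {ω | ∀ s ≤ t, Y s ω = v s} * P (v t) (v (t + 1))

/-- Independent agents `X 0, X 1, …`, each of which performs a random walk with transition
matrix `P` (each with its own initial distribution); `X n t` is the position of agent `n` at
time `t`. -/
structure IsAgentSystem [MeasurableSpace V] [MeasurableSpace Ω] (P : Matrix V V ℝ)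
    (μ : Measure Ω) (X : ℕ → ℕ → Ω → V) : Prop where
  walk : ∀ n, IsRandomWalk P μ (X n)
  indep : iIndepFun (fun n ω t => X n t ω) μ

/-- Link flow: the number of times that the first `N` agents traverse the link from `i` to `j`
during the first `T` time steps. -/
def linkFlow [DecidableEq V] (X : ℕ → ℕ → Ω → V) (N T : ℕ) (ω : Ω) : Matrix V V ℕ :=
  Matrix.of fun i j =>
    ∑ n ∈ Finset.range N, ((Finset.range T).filter
      fun t => X n t ω = i ∧ X n (t + 1) ω = j).card

/-- The minimum of the nonzero link flows (`0` if all link flows are zero). -/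
def minFlow (R : Matrix V V ℕ) : ℕ :=
  sInf {r : ℕ | r ≠ 0 ∧ ∃ i j, R i j = r}

/-- Relative flow: the link flows divided by the minimum nonzero link flow. -/
def relativeFlow (R : Matrix V V ℕ) : Matrix V V ℝ :=
  Matrix.of fun i j => (R i j : ℝ) / (minFlow R : ℝ)

/-- `F` is the ideal flow matrix of the agent system `X`: almost surely, the relative flow of
`N` agents over a period `T` tends to `F` as `T → ∞`, uniformly in the number `N ≥ 1` of agents
(so `N` may be fixed, or vary with `T` in any way). -/
def IsIdealFlow [DecidableEq V] [MeasurableSpace Ω] (μ : Measure Ω) (X : ℕ → ℕ → Ω → V)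
    (F : Matrix V V ℝ) : Prop :=
  ∀ᵐ ω ∂μ, Tendsto (fun p : ℕ × ℕ => relativeFlow (linkFlow X p.1 p.2 ω))
    (𝓟 {N : ℕ | 1 ≤ N} ×ˢ atTop) (𝓝 F)

end

/-! ### Poisson equation and stationary mean -/

section Poisson

variable [Fintype V] [DecidableEq V] {P : Matrix V V ℝ}

/-! For an irreducible `P` on a finite set, `f = h - P h + c f` is solvable for every `f`, where `c`
is a positive `P`-invariant functional. With `f v = 1_{v = i} P i j`, the indicator of a traversal
of `(i, j)` becomes a centred increment, plus a telescoping difference of `h`, plus `c f`. Over `N`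
agents and `T` steps the telescoping part is `O(N)`, negligible against `N T`. The centred part has
a Chernoff bound `exp (-δ N T)`, summable over all pairs, so Borel–Cantelli leaves finitely many bad
pairs: this gives uniformity in `N`, with no need for aperiodicity.

So flows divided by `N T` tend to `L i j = c f`, positive exactly on the links, and dividing by the
least nonzero flow only rescales `L`. Row and column sums of `L` at `k` are `c 1_k` and `c (P 1_k)`,
equal by invariance. -/

/-- Minimum principle: a superharmonic function of an irreducible stochastic matrix is constant. -/
theorem eq_of_mulVec_le (hP : P ∈ rowStochastic ℝ V) (hirr : P.IsIrreducible) {h : V → ℝ}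
    (hh : P *ᵥ h ≤ h) (v w : V) : h v = h w := by
  obtain ⟨m, -, hm⟩ := Finset.exists_min_image Finset.univ h ⟨v, Finset.mem_univ v⟩
  have step : ∀ a b, h a = h m → 0 < P a b → h b = h m := by
    intro a b ha hab
    have hsum : ∑ x, P a x * (h x - h m) ≤ 0 := by
      have h1 : ∑ x, P a x * h x ≤ h a := hh a
      simp only [mul_sub, Finset.sum_sub_distrib, ← Finset.sum_mul,
        sum_row_of_mem_rowStochastic hP]
      linarith
    have hnn : ∀ x ∈ Finset.univ, 0 ≤ P a x * (h x - h m) := fun x hx =>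
      mul_nonneg (hirr.nonneg a x) (sub_nonneg.2 (hm x hx))
    have h0 := (Finset.sum_eq_zero_iff_of_nonneg hnn).1
      (le_antisymm hsum (Finset.sum_nonneg hnn)) b (Finset.mem_univ b)
    rcases mul_eq_zero.1 h0 with h0 | h0
    · exact absurd h0 hab.ne'
    · linarith
  have key : ∀ a, h a = h m := by
    intro a
    let _ : Quiver V := toQuiver P
    obtain ⟨p, -⟩ := hirr.connected m a
    induction p with
    | nil => rfl
    | cons _ e ih => exact step _ _ ih e.down
  rw [key v, key w]

/-- The operator `h ↦ h - P h + h v₀ • 1`, which inverts the Poisson equation of `P`. -/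
def poissonOp (P : Matrix V V ℝ) (v₀ : V) : (V → ℝ) →ₗ[ℝ] (V → ℝ) where
  toFun h v := h v - (P *ᵥ h) v + h v₀
  map_add' f g := by ext v; simp only [mulVec_add, Pi.add_apply]; ring
  map_smul' c f := by
    ext v; simp only [mulVec_smul, Pi.smul_apply, smul_eq_mul, RingHom.id_apply]; ring

/-- Both `h v₀ ≥ 0` and `h v₀ ≤ 0` force a function in the kernel to be constant, hence zero. -/
theorem poissonOp_injective (hP : P ∈ rowStochastic ℝ V) (hirr : P.IsIrreducible) (v₀ : V) :
    Function.Injective (poissonOp P v₀) := by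
  rw [← LinearMap.ker_eq_bot, LinearMap.ker_eq_bot']
  suffices H : ∀ h, poissonOp P v₀ h = 0 → 0 ≤ h v₀ → h = 0 by
    intro h hh
    rcases le_total 0 (h v₀) with h0 | h0
    · exact H h hh h0
    · exact neg_eq_zero.1 (H (-h) (by rw [map_neg, hh, neg_zero]) (by simpa using h0))
  intro h hh h0
  have hv : ∀ v, h v - (P *ᵥ h) v + h v₀ = 0 := fun v => congrFun hh v
  -- On the kernel `P h = h + h v₀ ≥ h`, so `-h` is superharmonic.
  have hc : ∀ v w, (-h) v = (-h) w := eq_of_mulVec_le hP hirr fun v => by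
    have := hv v
    simp only [mulVec_neg, Pi.neg_apply]
    linarith
  have hc' : ∀ v, h v = h v₀ := fun v => neg_injective (hc v v₀)
  have h1 : (P *ᵥ h) v₀ = h v₀ := by
    simp only [mulVec, dotProduct, hc', ← Finset.sum_mul, sum_row_of_mem_rowStochastic hP, one_mul]
  ext v
  have := hv v₀
  simp only [Pi.zero_apply, hc' v]
  linarith

/-- The stationary mean of an irreducible stochastic matrix, together with the solvability of the
Poisson equation. -/
theorem exists_stationary_mean [Nonempty V] (hP : P ∈ rowStochastic ℝ V)
    (hirr : P.IsIrreducible) :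
    ∃ c : (V → ℝ) →ₗ[ℝ] ℝ, (∀ f, ∃ h : V → ℝ, ∀ v, f v = h v - (P *ᵥ h) v + c f) ∧
      (∀ f, c (P *ᵥ f) = c f) ∧ ∀ f, 0 ≤ f → f ≠ 0 → 0 < c f := by
  obtain ⟨v₀⟩ := ‹Nonempty V›
  have hinj := poissonOp_injective hP hirr v₀
  let e := LinearEquiv.ofInjectiveEndo (poissonOp P v₀) hinj
  -- The normalising term `h v₀` of the solution is the constant in the Poisson equation.
  let c : (V → ℝ) →ₗ[ℝ] ℝ := LinearMap.proj v₀ ∘ₗ e.symm.toLinearMap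
  have hsol : ∀ f v, f v = e.symm f v - (P *ᵥ e.symm f) v + c f := fun f v =>
    (congrFun (e.apply_symm_apply f) v).symm
  refine ⟨c, fun f => ⟨e.symm f, hsol f⟩, fun f => ?_, fun f hf hf0 => ?_⟩
  -- The solution for `f - P f` vanishes at `v₀`, which gives invariance of `c`.
  · have h1 : e (f - fun _ => f v₀) = f - P *ᵥ f := by
      have hconst : P *ᵥ (fun _ => f v₀) = fun _ => f v₀ := by
        ext v
        simp only [mulVec, dotProduct, ← Finset.sum_mul, sum_row_of_mem_rowStochastic hP, one_mul]
      ext v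
      change (f v - f v₀) - (P *ᵥ (f - fun _ => f v₀)) v + (f v₀ - f v₀) = f v - (P *ᵥ f) v
      rw [mulVec_sub, hconst, Pi.sub_apply]
      ring
    have h2 : c (f - P *ᵥ f) = 0 := by
      change e.symm (f - P *ᵥ f) v₀ = 0
      rw [← h1, e.symm_apply_apply]
      simp
    rw [map_sub] at h2
    linarith
  -- If `c f ≤ 0`, then `P h = h - f + c f ≤ h`; hence `h` is constant and `f = c f ≤ 0`.
  · by_contra! hc
    have hconst : ∀ v w, e.symm f v = e.symm f w := eq_of_mulVec_le hP hirr fun v => by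
      have := hsol f v
      have := hf v
      simp only [Pi.zero_apply] at this
      linarith
    refine hf0 (funext fun v => le_antisymm ?_ (hf v))
    have h1 : (P *ᵥ e.symm f) v = e.symm f v := by
      simp only [mulVec, dotProduct, fun w => hconst w v, ← Finset.sum_mul,
        sum_row_of_mem_rowStochastic hP, one_mul]
    rw [hsol f v, h1, sub_self, zero_add]
    exact hc

end Poisson

/-! ### Markov property of a single walk -/

section Walk

variable [Fintype V] [MeasurableSpace V] [MeasurableSingletonClass V]
  [MeasurableSpace Ω] {μ : Measure Ω} [IsProbabilityMeasure μ] {P : Matrix V V ℝ}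

/-- The expectation of a function of a random element of a finite type. -/
theorem integral_comp_eq_sum {A : Type*} [Fintype A] [MeasurableSpace A]
    [MeasurableSingletonClass A] {Z : Ω → A} (hZ : Measurable Z) (g : A → ℝ) :
    ∫ ω, g (Z ω) ∂μ = ∑ a, μ.real {ω | Z ω = a} * g a := by
  have : IsProbabilityMeasure (μ.map Z) := Measure.isProbabilityMeasure_map hZ.aemeasurable
  rw [← integral_map hZ.aemeasurable (Measurable.of_discrete (f := g)).aestronglyMeasurable,
    integral_fintype .of_finite]
  refine Finset.sum_congr rfl fun a _ => ?_
  rw [map_measureReal_apply hZ (measurableSet_singleton a), smul_eq_mul]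
  rfl

/-- Markov property: the expectation of a function of the last step, weighted by a function of the
past. -/
theorem IsRandomWalk.integral_step {Y : ℕ → Ω → V} (hY : IsRandomWalk P μ Y) (t : ℕ)
    (g : (Fin (t + 1) → V) → ℝ) (ψ : V → V → ℝ) :
    ∫ ω, g (fun s => Y s ω) * ψ (Y t ω) (Y (t + 1) ω) ∂μ =
      ∫ ω, g (fun s => Y s ω) * ∑ w, P (Y t ω) w * ψ (Y t ω) w ∂μ := by
  classical
  have hZ : Measurable fun ω (s : Fin (t + 1)) => Y s ω :=
    measurable_pi_lambda _ fun s => hY.measurable s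
  have h1 := integral_comp_eq_sum (μ := μ) (hZ.prodMk (hY.measurable (t + 1)))
    fun p => g p.1 * ψ (p.1 (Fin.last t)) p.2
  have h2 := integral_comp_eq_sum (μ := μ) hZ
    fun u => g u * ∑ w, P (u (Fin.last t)) w * ψ (u (Fin.last t)) w
  simp only [Fin.val_last] at h1 h2
  rw [h1, h2, Fintype.sum_prod_type]
  refine Finset.sum_congr rfl fun u _ => ?_
  rw [Finset.mul_sum, Finset.mul_sum]
  refine Finset.sum_congr rfl fun w _ => ?_
  -- The trajectory `u` followed by `w`; values after time `t + 1` are irrelevant.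
  have h3 := hY.transition t fun s => if hs : s < t + 1 then u ⟨s, hs⟩ else w
  have e1 : {ω | ((fun s : Fin (t + 1) => Y s ω), Y (t + 1) ω) = (u, w)} =
      {ω | ∀ s ≤ t + 1, Y s ω = if hs : s < t + 1 then u ⟨s, hs⟩ else w} := by
    ext ω
    simp only [Set.mem_ofPred_eq, Prod.mk.injEq, funext_iff]
    constructor
    · rintro ⟨ha, hb⟩ s hs
      split_ifs with h
      · exact ha ⟨s, h⟩
      · obtain rfl : s = t + 1 := by omega
        exact hb
    · refine fun h => ⟨fun s => ?_, ?_⟩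
      · exact (h s s.2.le).trans (dif_pos s.2)
      · simpa using h (t + 1) le_rfl
  have e2 : {ω | (fun s : Fin (t + 1) => Y s ω) = u} =
      {ω | ∀ s ≤ t, Y s ω = if hs : s < t + 1 then u ⟨s, hs⟩ else w} := by
    ext ω
    simp only [Set.mem_ofPred_eq, funext_iff]
    constructor
    · intro ha s hs
      rw [dif_pos (Nat.lt_succ_of_le hs)]
      exact ha ⟨s, Nat.lt_succ_of_le hs⟩
    · intro h s
      exact (h s (Nat.le_of_lt_succ s.2)).trans (dif_pos s.2)
  rw [e1, h3, ← e2]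
  simp only [lt_add_iff_pos_right, zero_lt_one, dite_true, lt_irrefl, dite_false]
  change _ * P (u (Fin.last t)) w * _ = _
  ring

/-- A multiplicative functional of a random walk grows at most geometrically in expectation. -/
theorem IsRandomWalk.integral_prod_le {Y : ℕ → Ω → V} (hY : IsRandomWalk P μ Y)
    {ψ : V → V → ℝ} (hψ : ∀ v w, 0 ≤ ψ v w) {q : ℝ} (hq : ∀ v, ∑ w, P v w * ψ v w ≤ q)
    (hq0 : 0 ≤ q) (t : ℕ) :
    ∫ ω, ∏ s ∈ Finset.range t, ψ (Y s ω) (Y (s + 1) ω) ∂μ ≤ q ^ t := by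
  induction t with
  | zero => simp
  | succ t ih =>
    let g : (Fin (t + 1) → V) → ℝ := fun u => ∏ s : Fin t, ψ (u s.castSucc) (u s.succ)
    have hg : ∀ ω, g (fun s => Y s ω) = ∏ s ∈ Finset.range t, ψ (Y s ω) (Y (s + 1) ω) :=
      fun ω => Fin.prod_univ_eq_prod_range (fun s => ψ (Y s ω) (Y (s + 1) ω)) t
    have hZ : Measurable fun ω (s : Fin (t + 1)) => Y s ω :=
      measurable_pi_lambda _ fun s => hY.measurable s
    have hint : ∀ G : (Fin (t + 1) → V) → ℝ, Integrable (fun ω => G (fun s => Y s ω)) μ :=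
      fun G => (Integrable.of_finite (μ := μ.map _) (f := G)).comp_measurable hZ
    simp only [Finset.prod_range_succ, ← hg] at ih ⊢
    rw [hY.integral_step t g ψ]
    calc ∫ ω, g (fun s => Y s ω) * ∑ w, P (Y t ω) w * ψ (Y t ω) w ∂μ
        ≤ ∫ ω, g (fun s => Y s ω) * q ∂μ := by
          refine integral_mono ?_ ((hint g).mul_const q) fun ω => ?_
          · exact hint fun u => g u * ∑ w, P (u (Fin.last t)) w * ψ (u (Fin.last t)) w
          · exact mul_le_mul_of_nonneg_left (hq _) (Finset.prod_nonneg fun _ _ => hψ _ _)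
      _ ≤ q ^ (t + 1) := by
          rw [integral_mul_const, pow_succ]
          gcongr

/-- Almost surely, a random walk never takes a step of probability zero. -/
theorem IsRandomWalk.ae_not_step {Y : ℕ → Ω → V} (hY : IsRandomWalk P μ Y) {i j : V}
    (hij : P i j = 0) (t : ℕ) : ∀ᵐ ω ∂μ, ¬ (Y t ω = i ∧ Y (t + 1) ω = j) := by
  classical
  have h := hY.integral_step t (fun _ => 1) fun v w => if v = i ∧ w = j then 1 else 0
  have h0 : ∀ v, ∑ w, P v w * (if v = i ∧ w = j then 1 else 0) = 0 := fun v =>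
    Finset.sum_eq_zero fun w _ => by
      split_ifs with hc
      · rw [hc.1, hc.2, hij, zero_mul]
      · rw [mul_zero]
  simp only [one_mul, h0, integral_zero] at h
  have hms : MeasurableSet {ω | Y t ω = i ∧ Y (t + 1) ω = j} :=
    ((hY.measurable t) (measurableSet_singleton i)).inter
      ((hY.measurable (t + 1)) (measurableSet_singleton j))
  have h1 : ∫ ω, {ω | Y t ω = i ∧ Y (t + 1) ω = j}.indicator (fun _ => (1 : ℝ)) ω ∂μ = 0 := by
    rw [← h]
    simp only [Set.indicator_apply, Set.mem_ofPred_eq]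
  rw [integral_indicator_const _ hms, smul_eq_mul, mul_one, measureReal_eq_zero_iff] at h1
  exact measure_eq_zero_iff_ae_notMem.1 h1

end Walk

/-! ### Chernoff bounds and the uniform strong law -/

section Concentration

variable [Fintype V]

/-- A small exponential tilt of centred bounded increments costs less than the linear rate `ε`. -/
theorem exists_sum_mul_exp_le [DecidableEq V] {P : Matrix V V ℝ}
    (hP : P ∈ rowStochastic ℝ V) {D : V → V → ℝ} (hD : ∀ v, ∑ w, P v w * D v w = 0) {ε : ℝ}
    (hε : 0 < ε) : ∃ r > 0, ∀ v, ∑ w, P v w * Real.exp (r * D v w) ≤ Real.exp (r * ε) := by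
  obtain ⟨B, hB⟩ := (Set.finite_range fun p : V × V => |D p.1 p.2|).bddAbove
  have hB' : ∀ v w, |D v w| ≤ |B| + 1 := fun v w => by
    have := hB ⟨(v, w), rfl⟩
    have := le_abs_self B
    simp only at *
    linarith
  set b := |B| + 1 with hb
  have hb0 : 0 < b := by positivity
  -- `r b ≤ 1` permits `exp x ≤ 1 + x + x ^ 2`; `r b ^ 2 ≤ ε` bounds the quadratic term by `r ε`.
  refine ⟨min (1 / b) (ε / b ^ 2), by positivity, fun v => ?_⟩
  set r := min (1 / b) (ε / b ^ 2) with hr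
  have hr0 : 0 < r := by positivity
  have hr1 : r * b ≤ 1 := by
    have := min_le_left (1 / b) (ε / b ^ 2)
    rwa [le_div_iff₀ hb0] at this
  have hr2 : r * b ^ 2 ≤ ε := by
    have := min_le_right (1 / b) (ε / b ^ 2)
    rwa [le_div_iff₀ (by positivity)] at this
  have hterm : ∀ w, Real.exp (r * D v w) ≤ 1 + r * D v w + r * ε := fun w => by
    have h1 : |r * D v w| ≤ r * b := by
      rw [abs_mul, abs_of_pos hr0]
      exact mul_le_mul_of_nonneg_left (hB' v w) hr0.le
    have h2 := (abs_le.1 (Real.abs_exp_sub_one_sub_id_le (h1.trans hr1))).2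
    have h3 : (r * D v w) ^ 2 ≤ (r * b) ^ 2 := sq_le_sq' (abs_le.1 h1).1 (abs_le.1 h1).2
    have h4 : r * (r * b ^ 2) ≤ r * ε := mul_le_mul_of_nonneg_left hr2 hr0.le
    nlinarith
  calc ∑ w, P v w * Real.exp (r * D v w)
      ≤ ∑ w, P v w * (1 + r * D v w + r * ε) :=
        Finset.sum_le_sum fun w _ =>
          mul_le_mul_of_nonneg_left (hterm w) (nonneg_of_mem_rowStochastic hP)
    _ = (∑ w, P v w) * (1 + r * ε) + r * ∑ w, P v w * D v w := by
        rw [Finset.sum_mul, Finset.mul_sum, ← Finset.sum_add_distrib]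
        exact Finset.sum_congr rfl fun w _ => by ring
    _ ≤ Real.exp (r * ε) := by
        rw [hD, sum_row_of_mem_rowStochastic hP]
        linarith [Real.add_one_le_exp (r * ε)]

variable [MeasurableSpace V] [MeasurableSingletonClass V]
  [MeasurableSpace Ω] {μ : Measure Ω} [IsProbabilityMeasure μ] {P : Matrix V V ℝ}

/-- Chernoff bound for an additive functional of a system of independent random walks. -/
theorem IsAgentSystem.measureReal_ge_le {X : ℕ → ℕ → Ω → V} (hX : IsAgentSystem P μ X)
    {D : V → V → ℝ} {r a : ℝ} (hr : 0 ≤ r)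
    (hD : ∀ v, ∑ w, P v w * Real.exp (r * D v w) ≤ Real.exp (r * a)) (b : ℝ) (N T : ℕ) :
    μ.real {ω | b * (N * T) ≤ ∑ n ∈ Finset.range N, ∑ t ∈ Finset.range T,
      D (X n t ω) (X n (t + 1) ω)} ≤ Real.exp (-(r * (b - a)) * (N * T)) := by
  let M : ℕ → Ω → ℝ := fun n ω => ∑ t ∈ Finset.range T, D (X n t ω) (X n (t + 1) ω)
  have hφ : Measurable fun u : ℕ → V => ∑ t ∈ Finset.range T, D (u t) (u (t + 1)) :=
    Finset.measurable_sum _ fun t _ =>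
      have hp : Measurable fun u : ℕ → V => (u t, u (t + 1)) := by fun_prop
      (Measurable.of_discrete (f := fun p : V × V => D p.1 p.2)).comp hp
  have hpath : ∀ n, Measurable fun ω t => X n t ω := fun n =>
    measurable_pi_lambda _ (hX.walk n).measurable
  have hM : ∀ n, Measurable (M n) := fun n => hφ.comp (hpath n)
  have hind : iIndepFun M μ := hX.indep.comp _ fun _ => hφ
  have hmgf : ∀ n, mgf (M n) μ r ≤ Real.exp (r * a) ^ T := fun n => by
    have := (hX.walk n).integral_prod_le (ψ := fun v w => Real.exp (r * D v w))
      (fun _ _ => (Real.exp_pos _).le) hD (Real.exp_pos _).le T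
    simpa only [mgf, M, Finset.mul_sum, Real.exp_sum] using this
  obtain ⟨C, hC⟩ := (Set.finite_range fun p : V × V => |D p.1 p.2|).bddAbove
  have hbound : ∀ ω, |(∑ n ∈ Finset.range N, M n) ω| ≤ N * (T * C) := fun ω => by
    have h1 : ∀ n, |M n ω| ≤ T * C := fun n => by
      refine (Finset.abs_sum_le_sum_abs _ _).trans ?_
      refine (Finset.sum_le_card_nsmul _ _ C fun t _ => hC ⟨(_, _), rfl⟩).trans ?_
      simp
    rw [Finset.sum_apply]
    refine (Finset.abs_sum_le_sum_abs _ _).trans ?_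
    refine (Finset.sum_le_card_nsmul _ _ _ fun n _ => h1 n).trans ?_
    simp
  have hSm : Measurable (∑ n ∈ Finset.range N, M n) := by fun_prop
  have hint : Integrable (fun ω => Real.exp (r * (∑ n ∈ Finset.range N, M n) ω)) μ := by
    refine .of_bound (hSm.const_mul r).exp.aestronglyMeasurable
      (Real.exp (r * (N * (T * C)))) (.of_forall fun ω => ?_)
    rw [Real.norm_eq_abs, Real.abs_exp]
    gcongr
    exact (abs_le.1 (hbound ω)).2
  have h := measure_ge_le_exp_mul_mgf (b * (N * T)) hr hint
  rw [hind.mgf_sum hM] at h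
  simp only [Finset.sum_apply, M] at h
  refine h.trans ?_
  calc Real.exp (-r * (b * (N * T))) * ∏ n ∈ Finset.range N, mgf (M n) μ r
      ≤ Real.exp (-r * (b * (N * T))) * ∏ n ∈ Finset.range N, Real.exp (r * a) ^ T := by
        gcongr with n
        · exact fun n _ => mgf_nonneg
        · exact hmgf n
    _ = Real.exp (-(r * (b - a)) * (N * T)) := by
        rw [Finset.prod_const, Finset.card_range, ← pow_mul, ← Real.exp_nat_mul, ← Real.exp_add]
        congr 1
        push_cast
        ring

/-- Since `(a + 1) (b + 1) ≥ a + b`, a product of two geometric series dominates. The shift avoids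
pairs with `N T = 0`, each contributing `1`. -/
theorem summable_exp_neg_mul_mul {δ : ℝ} (hδ : 0 < δ) :
    Summable fun p : ℕ × ℕ => Real.exp (-δ * (((p.1 + 1 : ℕ) : ℝ) * ((p.2 + 1 : ℕ) : ℝ))) := by
  have hg : Summable fun n : ℕ => Real.exp (-δ) ^ n :=
    summable_geometric_of_lt_one (Real.exp_pos _).le (Real.exp_lt_one_iff.2 (by linarith))
  refine Summable.of_nonneg_of_le (fun _ => (Real.exp_pos _).le) (fun p => ?_)
    (hg.mul_of_nonneg hg (fun _ => by positivity) fun _ => by positivity)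
  rw [← Real.exp_nat_mul, ← Real.exp_nat_mul, ← Real.exp_add]
  apply Real.exp_le_exp.2
  have h1 : (0 : ℝ) ≤ p.1 * p.2 := by positivity
  push_cast
  nlinarith

/-- Strong law for centred increments of independent random walks, uniformly in the number of
walks: one-sided version. -/
theorem IsAgentSystem.ae_eventually_sum_lt [DecidableEq V] {X : ℕ → ℕ → Ω → V}
    (hX : IsAgentSystem P μ X) (hP : P ∈ rowStochastic ℝ V) {D : V → V → ℝ}
    (hD : ∀ v, ∑ w, P v w * D v w = 0) {ε : ℝ} (hε : 0 < ε) :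
    ∀ᵐ ω ∂μ, ∀ᶠ p : ℕ × ℕ in 𝓟 {N : ℕ | 1 ≤ N} ×ˢ atTop,
      ∑ n ∈ Finset.range p.1, ∑ t ∈ Finset.range p.2, D (X n t ω) (X n (t + 1) ω) <
        ε * (p.1 * p.2) := by
  obtain ⟨r, hr, hrD⟩ := exists_sum_mul_exp_le hP hD (half_pos hε)
  let s : ℕ × ℕ → Set Ω := fun p => {ω | ε * ((p.1 + 1 : ℕ) * (p.2 + 1 : ℕ)) ≤
    ∑ n ∈ Finset.range (p.1 + 1), ∑ t ∈ Finset.range (p.2 + 1), D (X n t ω) (X n (t + 1) ω)}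
  have hs : ∑' p, μ (s p) ≠ ⊤ := by
    have hsum := summable_exp_neg_mul_mul (δ := r * (ε - ε / 2)) (mul_pos hr (by linarith))
    refine ne_top_of_le_ne_top hsum.tsum_ofReal_ne_top (ENNReal.tsum_le_tsum fun p => ?_)
    rw [← ofReal_measureReal]
    exact ENNReal.ofReal_le_ofReal (hX.measureReal_ge_le hr.le hrD ε (p.1 + 1) (p.2 + 1))
  filter_upwards [ae_finite_setOfPred_mem hs] with ω hω
  -- Bounding only the time coordinate of the finitely many bad pairs gives a threshold independent
  -- of `N`; the indices are shifted by one, whence `K + 2`.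
  obtain ⟨K, hK⟩ := (hω.image Prod.snd).bddAbove
  refine eventually_prod_iff.2 ⟨fun N => 1 ≤ N, mem_principal_self _, fun T => K + 2 ≤ T,
    eventually_ge_atTop _, fun {N} hN {T} hT => ?_⟩
  by_contra! hc
  obtain ⟨N, rfl⟩ := Nat.exists_eq_add_of_le' hN
  obtain ⟨T, rfl⟩ := Nat.exists_eq_add_of_le' (show 1 ≤ T by omega)
  have : T ≤ K := hK ⟨(N, T), hc, rfl⟩
  omega

/-- Strong law for centred increments of independent random walks, uniformly in the number of
walks. -/
theorem IsAgentSystem.ae_tendsto_sum_div [DecidableEq V] {X : ℕ → ℕ → Ω → V}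
    (hX : IsAgentSystem P μ X) (hP : P ∈ rowStochastic ℝ V) {D : V → V → ℝ}
    (hD : ∀ v, ∑ w, P v w * D v w = 0) :
    ∀ᵐ ω ∂μ, Tendsto (fun p : ℕ × ℕ => (∑ n ∈ Finset.range p.1, ∑ t ∈ Finset.range p.2,
      D (X n t ω) (X n (t + 1) ω)) / ((p.1 : ℝ) * p.2))
      (𝓟 {N : ℕ | 1 ≤ N} ×ˢ atTop) (𝓝 0) := by
  have hD' : ∀ v, ∑ w, P v w * (-D v w) = 0 := fun v => by
    simp only [mul_neg, Finset.sum_neg_distrib, hD, neg_zero]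
  have h1 := ae_all_iff.2 fun k : ℕ =>
    hX.ae_eventually_sum_lt hP hD (Nat.one_div_pos_of_nat (α := ℝ) (n := k))
  have h2 := ae_all_iff.2 fun k : ℕ =>
    hX.ae_eventually_sum_lt hP hD' (Nat.one_div_pos_of_nat (α := ℝ) (n := k))
  filter_upwards [h1, h2] with ω h1 h2
  rw [Metric.tendsto_nhds]
  intro ε hε
  obtain ⟨k, hk⟩ := exists_nat_one_div_lt hε
  have hpos : ∀ᶠ p : ℕ × ℕ in 𝓟 {N : ℕ | 1 ≤ N} ×ˢ atTop, 1 ≤ p.1 ∧ 1 ≤ p.2 :=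
    prod_mem_prod (mem_principal_self _) (Ici_mem_atTop 1)
  filter_upwards [h1 k, h2 k, hpos] with p h1 h2 hp
  have hNT : (0 : ℝ) < (p.1 : ℝ) * p.2 :=
    mul_pos (Nat.cast_pos.2 hp.1) (Nat.cast_pos.2 hp.2)
  simp only [Finset.sum_neg_distrib] at h2
  have hk' := mul_lt_mul_of_pos_right hk hNT
  rw [Real.dist_eq, sub_zero, abs_div, abs_of_pos hNT, div_lt_iff₀ hNT, abs_lt]
  constructor <;> linarith

end Concentration

/-! ### From normalised to relative flows -/

section Flow

/-- The link flow as a sum of indicators of traversals. -/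
theorem linkFlow_apply_cast [DecidableEq V] (X : ℕ → ℕ → Ω → V) (N T : ℕ) (ω : Ω) (i j : V) :
    (linkFlow X N T ω i j : ℝ) = ∑ n ∈ Finset.range N, ∑ t ∈ Finset.range T,
      if X n t ω = i ∧ X n (t + 1) ω = j then 1 else 0 := by
  simp [linkFlow, Finset.sum_boole]

/-- If the link flows, normalised by a positive factor, converge to `L`, and vanish wherever `L`
does, then the relative flows converge to `L` divided by its least nonzero entry. -/
theorem tendsto_relativeFlow [Fintype V] {ι : Type*} {l : Filter ι} {R : ι → Matrix V V ℕ}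
    {a : ι → ℝ} {L : Matrix V V ℝ} (ha : ∀ᶠ p in l, 0 < a p) (hL : ∀ i j, 0 ≤ L i j)
    {S : Finset (V × V)} (hS : S.Nonempty) (hSL : ∀ q, q ∈ S ↔ L q.1 q.2 ≠ 0)
    (h0 : ∀ i j, L i j = 0 → ∀ p, R p i j = 0)
    (hR : ∀ i j, Tendsto (fun p => (R p i j : ℝ) / a p) l (𝓝 (L i j))) :
    Tendsto (fun p => relativeFlow (R p)) l (𝓝 ((S.inf' hS fun q => L q.1 q.2)⁻¹ • L)) := by
  have hpos : ∀ q ∈ S, 0 < L q.1 q.2 := fun q hq =>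
    lt_of_le_of_ne (hL _ _) ((hSL q).1 hq).symm
  have hm : Tendsto (fun p => S.inf' hS fun q => (R p q.1 q.2 : ℝ) / a p) l
      (𝓝 (S.inf' hS fun q => L q.1 q.2)) :=
    Tendsto.finset_inf'_nhds_apply hS fun q _ => hR q.1 q.2
  have hm0 : 0 < S.inf' hS fun q => L q.1 q.2 := (Finset.lt_inf'_iff hS).2 hpos
  have hRpos : ∀ᶠ p in l, ∀ q ∈ S, 0 < (R p q.1 q.2 : ℝ) / a p :=
    (Finset.eventually_all S).2 fun q hq => (hR q.1 q.2).eventually (lt_mem_nhds (hpos q hq))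
  -- Eventually the nonzero flows are exactly those on `S`, so `minFlow` is a minimum over a fixed
  -- finite set, continuous in the flows.
  have hmin : ∀ᶠ p in l, (S.inf' hS fun q => (R p q.1 q.2 : ℝ) / a p) = minFlow (R p) / a p := by
    filter_upwards [ha, hRpos] with p ha hp
    obtain ⟨q, hq, he⟩ := S.exists_mem_eq_inf' hS fun q => (R p q.1 q.2 : ℝ) / a p
    have hleast : IsLeast {r : ℕ | r ≠ 0 ∧ ∃ i j, R p i j = r} (R p q.1 q.2) := by
      refine ⟨⟨fun h => ?_, q.1, q.2, rfl⟩, ?_⟩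
      · simpa [h] using hp q hq
      · rintro _ ⟨hr, i, j, rfl⟩
        have hij : (i, j) ∈ S :=
          (hSL _).2 fun h => hr (h0 i j h p)
        have := S.inf'_le (fun q => (R p q.1 q.2 : ℝ) / a p) hij
        rw [he, div_le_div_iff_of_pos_right ha] at this
        exact_mod_cast this
    rw [he, minFlow, hleast.csInf_eq]
  refine tendsto_pi_nhds.2 fun i => tendsto_pi_nhds.2 fun j => ?_
  have := (hR i j).div hm hm0.ne'
  rw [Matrix.smul_apply, smul_eq_mul, inv_mul_eq_div]
  refine this.congr' ?_
  filter_upwards [ha, hmin] with p ha hp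
  rw [Pi.div_apply, hp, div_div_div_cancel_right₀ ha.ne']
  rfl

end Flow

theorem IsPremagic.smul [Fintype V] {M : Matrix V V ℝ} (hM : IsPremagic M) (c : ℝ) :
    IsPremagic (c • M) := by
  unfold IsPremagic at *
  rw [vecMul_smul, smul_mulVec, hM]

/-! ### Limit flow and its balance -/

section Limit

variable [Fintype V] [DecidableEq V] [MeasurableSpace V] [MeasurableSingletonClass V]
  [MeasurableSpace Ω] {μ : Measure Ω} [IsProbabilityMeasure μ] {P : Matrix V V ℝ}

/-- The link flow per agent and time step converges, uniformly in the number of agents, to the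
constant of a Poisson equation. -/
theorem IsAgentSystem.ae_tendsto_linkFlow {X : ℕ → ℕ → Ω → V} (hX : IsAgentSystem P μ X)
    (hP : P ∈ rowStochastic ℝ V) {i j : V} {h : V → ℝ} {c : ℝ}
    (hpoisson : ∀ v, (if v = i then P i j else 0) = h v - (P *ᵥ h) v + c) :
    ∀ᵐ ω ∂μ, Tendsto (fun p : ℕ × ℕ => (linkFlow X p.1 p.2 ω i j : ℝ) / ((p.1 : ℝ) * p.2))
      (𝓟 {N : ℕ | 1 ≤ N} ×ˢ atTop) (𝓝 c) := by
  -- Two centred parts: the indicator minus its conditional mean, and the increment of `h` minus its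
  -- own. By the Poisson equation, `D v w` is the indicator `+ h w - h v - c`.
  let D : V → V → ℝ := fun v w =>
    (if v = i ∧ w = j then 1 else 0) - (if v = i then P i j else 0) + (h w - (P *ᵥ h) v)
  have hD : ∀ v, ∑ w, P v w * D v w = 0 := fun v => by
    have h1 : ∑ w, P v w * (if v = i ∧ w = j then 1 else 0) = if v = i then P i j else 0 := by
      by_cases hv : v = i <;> simp [hv]
    have h2 : ∑ w, P v w * h w = (P *ᵥ h) v := rfl
    simp only [D, mul_add, mul_sub, Finset.sum_add_distrib, Finset.sum_sub_distrib, h1, h2,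
      ← Finset.sum_mul, sum_row_of_mem_rowStochastic hP]
    ring
  obtain ⟨B, hB⟩ := (Set.finite_range fun v => |h v|).bddAbove
  filter_upwards [hX.ae_tendsto_sum_div hP hD] with ω hω
  have hflow : ∀ N T : ℕ, (linkFlow X N T ω i j : ℝ) =
      ∑ n ∈ Finset.range N, ∑ t ∈ Finset.range T, D (X n t ω) (X n (t + 1) ω) +
        ∑ n ∈ Finset.range N, (h (X n 0 ω) - h (X n T ω)) + N * T * c := fun N T => by
    have h1 : ∀ n, ∑ t ∈ Finset.range T,
        (if X n t ω = i ∧ X n (t + 1) ω = j then (1 : ℝ) else 0) =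
        ∑ t ∈ Finset.range T, D (X n t ω) (X n (t + 1) ω) + (h (X n 0 ω) - h (X n T ω)) + T * c := by
      intro n
      have h2 : (T : ℝ) * c = ∑ _t ∈ Finset.range T, c := by simp
      rw [h2, ← Finset.sum_range_sub' (fun t => h (X n t ω)), ← Finset.sum_add_distrib,
        ← Finset.sum_add_distrib]
      refine Finset.sum_congr rfl fun t _ => ?_
      have := hpoisson (X n t ω)
      simp only [D]
      linarith
    rw [linkFlow_apply_cast, Finset.sum_congr rfl fun n _ => h1 n, Finset.sum_add_distrib,
      Finset.sum_add_distrib, Finset.sum_const, Finset.card_range, nsmul_eq_mul]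
    ring
  have herr : Tendsto (fun p : ℕ × ℕ => (∑ n ∈ Finset.range p.1, (h (X n 0 ω) - h (X n p.2 ω))) /
      ((p.1 : ℝ) * p.2)) (𝓟 {N : ℕ | 1 ≤ N} ×ˢ atTop) (𝓝 0) := by
    have hT : Tendsto (fun p : ℕ × ℕ => 2 * B / (p.2 : ℝ)) (𝓟 {N : ℕ | 1 ≤ N} ×ˢ atTop) (𝓝 0) :=
      (tendsto_const_div_atTop_nhds_zero_nat (2 * B)).comp tendsto_snd
    refine squeeze_zero_norm' ?_ hT
    filter_upwards [prod_mem_prod (mem_principal_self _) (Ici_mem_atTop 1)] with p hp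
    have hN : (0 : ℝ) < p.1 := Nat.cast_pos.2 hp.1
    have hT : (0 : ℝ) < p.2 := Nat.cast_pos.2 hp.2
    have h1 : |∑ n ∈ Finset.range p.1, (h (X n 0 ω) - h (X n p.2 ω))| ≤ p.1 * (2 * B) := by
      refine (Finset.abs_sum_le_sum_abs _ _).trans ?_
      refine (Finset.sum_le_card_nsmul _ _ (2 * B) fun n _ => ?_).trans (by simp)
      have := hB ⟨X n 0 ω, rfl⟩
      have := hB ⟨X n p.2 ω, rfl⟩
      have := abs_sub (h (X n 0 ω)) (h (X n p.2 ω))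
      simp only at *
      linarith
    rw [Real.norm_eq_abs, abs_div, abs_of_pos (mul_pos hN hT), div_le_div_iff₀ (mul_pos hN hT) hT]
    nlinarith
  have hsum := (hω.add herr).add_const c
  rw [add_zero, zero_add] at hsum
  refine hsum.congr' ?_
  filter_upwards [prod_mem_prod (mem_principal_self _) (Ici_mem_atTop 1)] with p hp
  have hN : (p.1 : ℝ) ≠ 0 := (Nat.cast_pos.2 hp.1).ne'
  have hT : (p.2 : ℝ) ≠ 0 := (Nat.cast_pos.2 hp.2).ne'
  rw [hflow, add_div, add_div, mul_div_cancel_left₀ c (mul_ne_zero hN hT)]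

/-- An agent system has an ideal flow matrix which is premagic. -/
theorem IsAgentSystem.exists_isIdealFlow_isPremagic {X : ℕ → ℕ → Ω → V}
    (hX : IsAgentSystem P μ X) (hP : P ∈ rowStochastic ℝ V) (hirr : P.IsIrreducible) :
    ∃ F : Matrix V V ℝ, IsIdealFlow μ X F ∧ IsPremagic F := by
  obtain ⟨ω₀⟩ := nonempty_of_isProbabilityMeasure μ
  have v₀ : V := X 0 0 ω₀
  have : Nonempty V := ⟨v₀⟩
  obtain ⟨c, hsol, hstat, hpos⟩ := exists_stationary_mean hP hirr
  let f : V → V → V → ℝ := fun i j v => if v = i then P i j else 0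
  let L : Matrix V V ℝ := Matrix.of fun i j => c (f i j)
  have hLpos : ∀ i j, P i j ≠ 0 → 0 < L i j := fun i j hij =>
    hpos _ (fun v => by
      dsimp only [f]
      split_ifs
      exacts [hirr.nonneg i j, le_rfl]) fun h => hij (by simpa [f] using congrFun h i)
  have hLzero : ∀ i j, P i j = 0 → L i j = 0 := fun i j hij => by
    have : f i j = 0 := by ext v; simp [f, hij]
    simp only [L, of_apply, this, map_zero]
  have hLnn : ∀ i j, 0 ≤ L i j := fun i j => by
    by_cases hij : P i j = 0
    exacts [(hLzero i j hij).ge, (hLpos i j hij).le]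
  have hLne : ∃ i j, L i j ≠ 0 := by
    by_contra! hc
    have h1 : ∑ j, P v₀ j = 0 := Finset.sum_eq_zero fun j _ => by
      by_contra hj
      exact (hLpos v₀ j hj).ne' (hc v₀ j)
    rw [sum_row_of_mem_rowStochastic hP] at h1
    exact one_ne_zero h1
  have hconv : ∀ᵐ ω ∂μ, ∀ i j, Tendsto
      (fun p : ℕ × ℕ => (linkFlow X p.1 p.2 ω i j : ℝ) / ((p.1 : ℝ) * p.2))
      (𝓟 {N : ℕ | 1 ≤ N} ×ˢ atTop) (𝓝 (L i j)) :=
    ae_all_iff.2 fun i => ae_all_iff.2 fun j => by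
      obtain ⟨h, hh⟩ := hsol (f i j)
      exact hX.ae_tendsto_linkFlow hP hh
  have hzero : ∀ᵐ ω ∂μ, ∀ i j, P i j = 0 → ∀ n t, ¬ (X n t ω = i ∧ X n (t + 1) ω = j) := by
    simp only [ae_all_iff]
    exact fun i j hij n t => (hX.walk n).ae_not_step hij t
  have hNT : ∀ᶠ p : ℕ × ℕ in 𝓟 {N : ℕ | 1 ≤ N} ×ˢ atTop, (0 : ℝ) < (p.1 : ℝ) * p.2 := by
    filter_upwards [prod_mem_prod (mem_principal_self _) (Ici_mem_atTop 1)] with p hp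
    exact mul_pos (Nat.cast_pos.2 hp.1) (Nat.cast_pos.2 hp.2)
  let S : Finset (V × V) := Finset.univ.filter fun q => L q.1 q.2 ≠ 0
  have hSL : ∀ q, q ∈ S ↔ L q.1 q.2 ≠ 0 := fun q => by simp [S]
  have hS : S.Nonempty := by
    obtain ⟨i, j, hij⟩ := hLne
    exact ⟨(i, j), (hSL _).2 hij⟩
  refine ⟨(S.inf' hS fun q => L q.1 q.2)⁻¹ • L, ?_, IsPremagic.smul ?_ _⟩
  · filter_upwards [hconv, hzero] with ω hconv hzero
    refine tendsto_relativeFlow hNT hLnn hS hSL (fun i j hij p => ?_) hconv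
    have hPij : P i j = 0 := by
      by_contra hne
      exact (hLpos i j hne).ne' hij
    have := hzero i j hPij
    simp only [linkFlow, of_apply, this, Finset.filter_false, Finset.card_empty,
      Finset.sum_const_zero]
  · ext k
    have hrow : ∑ j, f k j = Pi.single k 1 := by
      ext v
      by_cases hv : v = k
      · simp [f, hv, sum_row_of_mem_rowStochastic hP]
      · simp [f, hv]
    have hcol : ∑ j, f j k = P *ᵥ Pi.single k 1 := by
      ext v
      simp [f]
    simp only [vecMul, mulVec, dotProduct, one_mul, mul_one, L, of_apply, ← map_sum, hrow, hcol,
      hstat]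

end Limit

theorem corollary2 {V : Type*} [Fintype V] [DecidableEq V]
    [MeasurableSpace V] [MeasurableSingletonClass V]
    {Ω : Type*} [MeasurableSpace Ω] (μ : Measure Ω) [IsProbabilityMeasure μ]
    (P : Matrix V V ℝ) (hstoch : P ∈ Matrix.rowStochastic ℝ V) (hirr : P.IsIrreducible)
    (X : ℕ → ℕ → Ω → V) (hX : IsAgentSystem P μ X) :
    (∃ F : Matrix V V ℝ, IsIdealFlow μ X F) ∧
      ∀ F : Matrix V V ℝ, IsIdealFlow μ X F → IsPremagic F := by
  obtain ⟨F, hF, hmagic⟩ := hX.exists_isIdealFlow_isPremagic hstoch hirr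
  refine ⟨⟨F, hF⟩, fun G hG => ?_⟩
  -- One common sample point suffices to identify `G` with `F`.
  obtain ⟨ω, hFω, hGω⟩ := (hF.and hG).exists
  have : NeBot (𝓟 {N : ℕ | 1 ≤ N}) := principal_neBot_iff.2 ⟨1, le_refl 1⟩
  exact tendsto_nhds_unique hFω hGω ▸ hmagic
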